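/- For real numbers $\tau\ge 0$ and $c\ge 2$ let $\psi(z,c)=z^2-cz-e^{-zc\tau}$, $z\in\mathbb C$. For $c>0$ let $w(c)>0$ be given by $w(c)^2=\tfrac12\left(\sqrt{c^4+4}-c^2\right)$, and put $$\tau_2=\frac{\arccos(2-\sqrt5)}{2\sqrt{\sqrt5-2}}=1.86173\dots$$ Define $c^\star:[0,\infty)\to(0,+\infty]$ by $c^\star(\tau)=+\infty$ for $0\le\tau\le\pi/2$, while for $\tau>\pi/2$ the value $c^\star(\tau)$ is given implicitly as the number $c>0$ with $$\tau=\frac{\arccos\left(-w(c)^2\right)}{c\,w(c)} .$$ Then $1.86173\le\tau_2<1.86174$, $c^\star$ is well defined (for each $\tau>\pi/2$ the last equation has exactly one solution $c>0$), and $c^\star(\tau)\ge 2$ if and only if $\tau\le\tau_2$. For all $\tau\ge0$ and $c\ge2$: 1. The function $\psi(\cdot,c)$ has exactly one zero, counting multiplicity, in the open half-plane $\operatorname{Re} z>0$ if and only if one of the following holds: (a) $0\le\tau\le\pi/2$ and $c\le c^\star(\tau)=+\infty$; (b) $\pi/2<\tau\le\tau_2$ and $c\le c^\star(\tau)$. 2.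 If $c>c^\star(\tau)$, then every zero $\lambda$ of $\psi(\cdot,c)$ with $\operatorname{Re}\lambda\le0$ satisfies $|\operatorname{Im}\lambda|>2\pi/(c\tau)$. -/

import Mathlib

noncomputable section

/-- The characteristic function `ψ(z, c) = z² - c z - exp (-z c τ)`, with the delay `τ` explicit. -/
def charFun8 (τ c : ℝ) (z : ℂ) : ℂ :=
  z ^ 2 - (c : ℂ) * z - Complex.exp (-z * (c : ℂ) * (τ : ℂ))

/-- `f` has exactly one zero in `S`, counting multiplicity: there is precisely one point of `S`
at which `f` vanishes, and `f` vanishes there to order one. -/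
def HasExactlyOneZeroIn (f : ℂ → ℂ) (S : Set ℂ) : Prop :=
  ∃ z ∈ S, f z = 0 ∧ analyticOrderAt f z = 1 ∧ ∀ z' ∈ S, f z' = 0 → z' = z

/-- The positive number `w(c)` with `w(c)² = (√(c⁴ + 4) - c²) / 2`. -/
def critFreq (c : ℝ) : ℝ := Real.sqrt ((Real.sqrt (c ^ 4 + 4) - c ^ 2) / 2)

/-- `C = c⋆(τ)`, as an extended real: `c⋆(τ) = +∞` for `τ ≤ π/2`, while for `τ > π/2` it is a
positive real number `c` which solves `τ = arccos (-w(c)²) / (c w(c))`. -/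
def IsCritSpeed (τ : ℝ) (C : EReal) : Prop :=
  (τ ≤ Real.pi / 2 ∧ C = ⊤) ∨
    (Real.pi / 2 < τ ∧ ∃ c : ℝ, 0 < c ∧ C = (c : EReal) ∧
      τ = Real.arccos (-(critFreq c) ^ 2) / (c * critFreq c))

/-- The delay `τ₂ = 1.86173…`, for which `c⋆(τ₂) = 2`. -/
def tauTwo : ℝ :=
  Real.arccos (2 - Real.sqrt 5) / (2 * Real.sqrt (Real.sqrt 5 - 2))

end

/-! ### The critical frequency and the critical delay -/

/-! With `h = c τ` the zeros solve `z (z - c) = exp (-h z)`. At `z = i y`, `y > 0`, the modulus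
forces `y = w(c)`, and the phase then forces `h y - arctan (y / c) = π / 2` modulo `2π`; the
smallest such delay is `critDelay c`. It decreases strictly in `c` and takes every value above `π /
2`, so `c ≤ c⋆(τ)` means `τ ≤ critDelay c`, and `τ₂ = critDelay 2`.

No continuity of zeros in `τ` is used. For a zero `x + i y`, `y > 0`, eliminating between real and
imaginary parts shows that, for `x < c / 2`, `c cos (h y) + y sin (h y)` has the sign of `-x`. That
expression is a positive multiple of `cos (h y - arctan (y / c))`, so monotonicity of the phase
compares `y` with `w(c)`, and the modulus equation contradicts the outcome. This excludes non-real
zeros on the right before the critical delay (`IsCharRoot.not_pos_pos`) and slow ones on the left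
after it (`IsCharRoot.two_pi_lt`). Past the critical delay, an intermediate value argument along a
curve of correct phase yields a conjugate pair on the right (`exists_isCharRoot_pos`), besides the
simple real zero that is always there. -/

theorem critFreq_sq (c : ℝ) : critFreq c ^ 2 = (Real.sqrt (c ^ 4 + 4) - c ^ 2) / 2 := by
  have h : c ^ 2 ≤ Real.sqrt (c ^ 4 + 4) := Real.le_sqrt_of_sq_le (by nlinarith)
  rw [critFreq, Real.sq_sqrt (by linarith)]

theorem critFreq_sq_mul (c : ℝ) : critFreq c ^ 2 * (critFreq c ^ 2 + c ^ 2) = 1 := by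
  have h := Real.sq_sqrt (show (0 : ℝ) ≤ c ^ 4 + 4 by positivity)
  rw [critFreq_sq]
  nlinarith

theorem critFreq_pos (c : ℝ) : 0 < critFreq c := by
  have h0 : 0 ≤ critFreq c := Real.sqrt_nonneg _
  rcases h0.lt_or_eq with h | h
  · exact h
  · have := critFreq_sq_mul c
    rw [← h] at this
    norm_num at this

theorem critFreq_lt_one {c : ℝ} (hc : 0 < c) : critFreq c < 1 := by
  have h := critFreq_sq_mul c
  have hw := critFreq_pos c
  by_contra hn
  have h1 : 1 ≤ critFreq c ^ 2 := by nlinarith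
  nlinarith [pow_pos hc 2]

theorem eq_critFreq {c w : ℝ} (hw : 0 < w) (h : w ^ 2 * (w ^ 2 + c ^ 2) = 1) :
    critFreq c = w := by
  have h' := critFreq_sq_mul c
  have hp := critFreq_pos c
  have h2 : (critFreq c ^ 2 - w ^ 2) * (critFreq c ^ 2 + w ^ 2 + c ^ 2) = 0 := by linarith
  rcases mul_eq_zero.1 h2 with h3 | h3
  · exact (pow_left_inj₀ hp.le hw.le two_ne_zero).1 (by linarith)
  · have : 0 < critFreq c ^ 2 + w ^ 2 + c ^ 2 := by positivity
    linarith

theorem mul_critFreq {c : ℝ} (hc : 0 < c) :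
    c * critFreq c = Real.sqrt (1 - (critFreq c ^ 2) ^ 2) := by
  have hp := critFreq_pos c
  rw [eq_comm, Real.sqrt_eq_iff_mul_self_eq_of_pos (by positivity)]
  linarith [critFreq_sq_mul c]

/-- Turns the delay formula into the phase condition at the critical frequency. -/
theorem arccos_neg_critFreq_sq {c : ℝ} (hc : 0 < c) :
    Real.arccos (-critFreq c ^ 2) = Real.pi / 2 + Real.arctan (critFreq c / c) := by
  have hp := critFreq_pos c
  have h1 := critFreq_lt_one hc
  rw [Real.arccos_eq_pi_div_two_sub_arcsin, Real.arcsin_neg,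
    Real.arcsin_eq_arctan ⟨by nlinarith, by nlinarith⟩, ← mul_critFreq hc]
  have : critFreq c ^ 2 / (c * critFreq c) = critFreq c / c := by field_simp
  rw [this]
  ring

theorem critFreq_strictAntiOn : StrictAntiOn critFreq (Set.Ioi 0) := by
  intro a ha b hb hab
  have ha' : (0 : ℝ) < a := ha
  have h1 := critFreq_sq_mul a
  have h2 := critFreq_sq_mul b
  have p1 := critFreq_pos a
  have p2 := critFreq_pos b
  by_contra hn
  push Not at hn
  have h3 : critFreq a ^ 2 ≤ critFreq b ^ 2 := by gcongr
  have h4 : a ^ 2 < b ^ 2 := by gcongr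
  have h5 : critFreq a ^ 2 * (critFreq a ^ 2 + a ^ 2) < critFreq b ^ 2 * (critFreq b ^ 2 + b ^ 2) :=
    mul_lt_mul' h3 (by linarith) (by positivity) (by positivity)
  linarith

/-- The delay at which a pair of imaginary zeros first appears. -/
noncomputable def critDelay (c : ℝ) : ℝ := Real.arccos (-critFreq c ^ 2) / (c * critFreq c)

/-- As `c` grows, `w` falls, so the numerator falls while `c w = √(1 - w⁴)` rises. -/
theorem critDelay_strictAntiOn : StrictAntiOn critDelay (Set.Ioi 0) := by
  intro a ha b hb hab
  have ha' : (0 : ℝ) < a := ha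
  have hb' : (0 : ℝ) < b := hb
  have hw := critFreq_strictAntiOn ha hb hab
  have p1 := critFreq_pos a
  have p2 := critFreq_pos b
  have l1 := critFreq_lt_one ha'
  have hsq : critFreq b ^ 2 < critFreq a ^ 2 := by gcongr
  have hnum : Real.arccos (-critFreq b ^ 2) < Real.arccos (-critFreq a ^ 2) :=
    Real.arccos_lt_arccos (by nlinarith) (by linarith) (by nlinarith)
  have hden : a * critFreq a ≤ b * critFreq b := by
    rw [mul_critFreq ha', mul_critFreq hb']
    gcongr
  have hpos : 0 < a * critFreq a := by positivity
  unfold critDelay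
  exact div_lt_div₀ hnum hden (Real.arccos_nonneg _) hpos

theorem pi_div_two_lt_critDelay {c : ℝ} (hc : 0 < c) : Real.pi / 2 < critDelay c := by
  have hp := critFreq_pos c
  have h1 := critFreq_lt_one hc
  have hlt : c * critFreq c < 1 := by
    have := critFreq_sq_mul c
    by_contra hn
    have h2 : 1 ≤ (c * critFreq c) ^ 2 := by nlinarith
    nlinarith [pow_pos hp 4]
  have ha : 0 < Real.arctan (critFreq c / c) := Real.arctan_pos.2 (by positivity)
  rw [critDelay, arccos_neg_critFreq_sq hc, lt_div_iff₀ (by positivity)]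
  nlinarith [Real.pi_pos]

theorem exists_critDelay_eq {τ : ℝ} (hτ : Real.pi / 2 < τ) : ∃ c, 0 < c ∧ critDelay c = τ := by
  have hpi := Real.pi_pos
  -- Parametrize by the angle: `w² = -cos θ` and `c w = sin θ` turn the equation into `τ = θ / sin
  -- θ`.
  obtain ⟨θ, ⟨h1, h2⟩, h3⟩ := intermediate_value_Icc' (f := fun θ => τ * Real.sin θ - θ)
    (show Real.pi / 2 ≤ Real.pi by linarith) (by fun_prop)
    (show (0 : ℝ) ∈ _ by simp; constructor <;> linarith)
  simp only at h3
  have h1' : Real.pi / 2 < θ := by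
    rcases h1.lt_or_eq with h | h
    · exact h
    · rw [← h] at h3; simp at h3; linarith
  have h2' : θ < Real.pi := by
    rcases h2.lt_or_eq with h | h
    · exact h
    · rw [h] at h3; simp at h3
  have hs : 0 < Real.sin θ := Real.sin_pos_of_pos_of_lt_pi (by linarith) h2'
  have hcos : Real.cos θ < 0 := Real.cos_neg_of_pi_div_two_lt_of_lt h1' (by linarith)
  set r := Real.sqrt (-Real.cos θ) with hr
  have hr0 : 0 < r := Real.sqrt_pos.2 (by linarith)
  have hr2 : r ^ 2 = -Real.cos θ := Real.sq_sqrt (by linarith)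
  have hw : critFreq (Real.sin θ / r) = r := by
    apply eq_critFreq hr0
    have := Real.sin_sq_add_cos_sq θ
    have h4 : r ^ 2 * (r ^ 2 + (Real.sin θ / r) ^ 2) = (r ^ 2) ^ 2 + Real.sin θ ^ 2 := by
      field_simp
    rw [h4, hr2]
    linarith
  refine ⟨Real.sin θ / r, by positivity, ?_⟩
  rw [critDelay, hw, hr2, neg_neg, Real.arccos_cos (by linarith) h2, div_mul_cancel₀ _ hr0.ne',
    div_eq_iff hs.ne']
  linarith

theorem tauTwo_eq : tauTwo = critDelay 2 := by
  have h5 : (Real.sqrt 5) ^ 2 = 5 := Real.sq_sqrt (by norm_num)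
  have h52 : (2 : ℝ) < Real.sqrt 5 := Real.lt_sqrt_of_sq_lt (by norm_num)
  have hw : critFreq 2 = Real.sqrt (Real.sqrt 5 - 2) := by
    apply eq_critFreq (Real.sqrt_pos.2 (by linarith))
    rw [Real.sq_sqrt (by linarith)]
    nlinarith
  rw [critDelay, hw, Real.sq_sqrt (by linarith), tauTwo]
  ring_nf

theorem tauTwo_bounds : 1.86173 ≤ tauTwo ∧ tauTwo < 1.86174 := by
  have h5a : (2.2360679774 : ℝ) < Real.sqrt 5 := Real.lt_sqrt_of_sq_lt (by norm_num)
  have h5b : Real.sqrt 5 < (2.2360679775 : ℝ) := (Real.sqrt_lt' (by norm_num)).2 (by norm_num)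
  have hsa : (0.48586827 : ℝ) < Real.sqrt (Real.sqrt 5 - 2) :=
    Real.lt_sqrt_of_sq_lt (by norm_num; linarith)
  have hsb : Real.sqrt (Real.sqrt 5 - 2) < (0.48586828 : ℝ) :=
    (Real.sqrt_lt' (by norm_num)).2 (by norm_num; linarith)
  have hpa := Real.pi_gt_d20
  have hpb := Real.pi_lt_d20
  have hacos : Real.arccos (2 - Real.sqrt 5) = Real.pi / 2 + Real.arcsin (Real.sqrt 5 - 2) := by
    rw [Real.arccos_eq_pi_div_two_sub_arcsin, ← neg_sub (Real.sqrt 5) 2, Real.arcsin_neg]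
    ring
  -- The targets require `arcsin (√5 - 2)` to lie between about `0.2383148` and `0.2383245`, that is
  -- `2 √(√5 - 2) τ - π / 2` at the two bounds.
  have hlo : (0.238315 : ℝ) ≤ Real.arcsin (Real.sqrt 5 - 2) := by
    rw [Real.le_arcsin_iff_sin_le' ⟨by linarith, by linarith⟩]
    have := (abs_le.1 (Real.sin_bound (x := 0.238315) (by norm_num [abs_of_pos]))).2
    rw [abs_of_pos (by norm_num)] at this
    norm_num at this ⊢
    linarith
  have hhi : Real.arcsin (Real.sqrt 5 - 2) ≤ (0.2383243 : ℝ) := by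
    rw [Real.arcsin_le_iff_le_sin' ⟨by linarith, by linarith⟩]
    have := Real.sin_gt_sub_cube (x := 0.2383243) (by norm_num)
    norm_num at this ⊢
    linarith
  rw [tauTwo, hacos, le_div_iff₀ (by linarith), div_lt_iff₀ (by linarith)]
  constructor <;> norm_num at * <;> linarith

/-! ### Zeros of the characteristic function in real coordinates -/

theorem charFun8_eq_zero_iff (τ c : ℝ) (z : ℂ) :
    charFun8 τ c z = 0 ↔
      z.re ^ 2 - z.im ^ 2 - c * z.re = Real.exp (-(c * τ * z.re)) * Real.cos (c * τ * z.im) ∧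
      2 * z.re * z.im - c * z.im = -(Real.exp (-(c * τ * z.re)) * Real.sin (c * τ * z.im)) := by
  have h1 : (-z * (c : ℂ) * (τ : ℂ)).re = -(c * τ * z.re) := by
    simp only [Complex.re_mul_ofReal, Complex.neg_re]; ring
  have h2 : (-z * (c : ℂ) * (τ : ℂ)).im = -(c * τ * z.im) := by
    simp only [Complex.im_mul_ofReal, Complex.neg_im]; ring
  rw [Complex.ext_iff, charFun8]
  simp only [Complex.sub_re, Complex.sub_im, Complex.exp_re, Complex.exp_im, h1, h2, pow_two,
    Complex.mul_re, Complex.mul_im, Complex.ofReal_re, Complex.ofReal_im, Complex.zero_re,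
    Complex.zero_im, Real.cos_neg, Real.sin_neg]
  constructor
  · rintro ⟨a, b⟩
    constructor <;> linarith
  · rintro ⟨a, b⟩
    constructor <;> linarith

/-- The real and imaginary parts of the equation `z (z - c) = exp (-h z)` at `z = x + i y`. -/
def IsCharRoot (h c x y : ℝ) : Prop :=
  x ^ 2 - y ^ 2 - c * x = Real.exp (-(h * x)) * Real.cos (h * y) ∧
    2 * x * y - c * y = -(Real.exp (-(h * x)) * Real.sin (h * y))

theorem IsCharRoot.neg {h c x y : ℝ} (H : IsCharRoot h c x y) : IsCharRoot h c x (-y) := by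
  refine ⟨?_, ?_⟩
  · rw [mul_neg, Real.cos_neg, ← H.1]; ring
  · rw [mul_neg h, Real.sin_neg]; linarith [H.2]

theorem IsCharRoot.modulus {h c x y : ℝ} (H : IsCharRoot h c x y) :
    (x ^ 2 + y ^ 2) * ((c - x) ^ 2 + y ^ 2) = Real.exp (-(h * x)) ^ 2 := by
  have := Real.sin_sq_add_cos_sq (h * y)
  calc _ = (x ^ 2 - y ^ 2 - c * x) ^ 2 + (2 * x * y - c * y) ^ 2 := by ring
    _ = Real.exp (-(h * x)) ^ 2 * (Real.sin (h * y) ^ 2 + Real.cos (h * y) ^ 2) := by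
      rw [H.1, H.2]; ring
    _ = _ := by rw [this, mul_one]

/-- This combination vanishes on the imaginary axis, so its sign tells the side of the axis. -/
theorem IsCharRoot.exp_mul {h c x y : ℝ} (H : IsCharRoot h c x y) :
    Real.exp (-(h * x)) * (c * Real.cos (h * y) + y * Real.sin (h * y)) =
      -x * (c * (c - x) + 2 * y ^ 2) := by
  linear_combination -c * H.1 + y * H.2

/-! ### Phase monotonicity and non-real zeros -/

theorem mul_cos_sub_arctan {c : ℝ} (hc : c ≠ 0) (φ y : ℝ) :
    c * Real.cos (φ - Real.arctan (y / c)) =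
      Real.cos (Real.arctan (y / c)) * (c * Real.cos φ + y * Real.sin φ) := by
  have h := Real.tan_arctan (y / c)
  rw [Real.tan_eq_sin_div_cos, div_eq_iff (Real.cos_arctan_pos _).ne'] at h
  rw [Real.cos_sub, h]
  field_simp

theorem strictMono_mul_sub_arctan {h c : ℝ} (hc : 0 < c) (hh : 1 < h * c) :
    StrictMono fun y => h * y - Real.arctan (y / c) := by
  apply strictMono_of_deriv_pos
  intro y
  have hd : HasDerivAt (fun y => h * y - Real.arctan (y / c))
      (h * 1 - 1 / (1 + (y / c) ^ 2) * (1 / c)) y :=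
    ((hasDerivAt_id y).const_mul h).sub (((hasDerivAt_id y).div_const c).arctan)
  rw [hd.deriv]
  have h1 : 1 / (1 + (y / c) ^ 2) ≤ 1 := by
    rw [div_le_one (by positivity)]
    nlinarith [sq_nonneg (y / c)]
  have h2 : 1 / c < h := by rwa [div_lt_iff₀ hc]
  have h3 : 0 < 1 / c := by positivity
  nlinarith

theorem one_lt_mul_of_le_mul_critFreq {h c : ℝ} (hc : 2 ≤ c)
    (hh : Real.pi / 2 + Real.arctan (critFreq c / c) ≤ h * critFreq c) :
    1 < h * c ∧ Real.pi / 2 * c < h := by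
  have hp := critFreq_pos c
  have ha : 0 < Real.arctan (critFreq c / c) := Real.arctan_pos.2 (by positivity)
  have hw : critFreq c * c < 1 := by
    have := critFreq_sq_mul c
    by_contra hn
    have h2 : 1 ≤ (c * critFreq c) ^ 2 := by nlinarith
    nlinarith [pow_pos hp 4]
  have hpi := Real.pi_gt_three
  have h0 : 0 < h := by
    by_contra hn
    nlinarith
  have h1 : Real.pi / 2 * c < h := by
    have h3 : Real.pi / 2 * c < h * critFreq c * c := by nlinarith
    nlinarith
  exact ⟨by nlinarith, h1⟩

theorem critFreq_lt_of_phase_neg {h c y : ℝ} (hc : 2 ≤ c) (hh0 : 0 ≤ h)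
    (hh : h * critFreq c ≤ Real.pi / 2 + Real.arctan (critFreq c / c)) (hy : 0 < y)
    (hN : c * Real.cos (h * y) + y * Real.sin (h * y) < 0) : critFreq c < y := by
  have hpi := Real.pi_pos
  have hwp := critFreq_pos c
  have hφ0 : 0 ≤ h * y := by positivity
  by_contra hn
  push Not at hn
  -- The phase need not be monotone for `h` itself, so the comparison is made at the critical value
  -- `h₀ ≥ h`.
  set h₀ := (Real.pi / 2 + Real.arctan (critFreq c / c)) / critFreq c with hh₀
  have e : h₀ * critFreq c = Real.pi / 2 + Real.arctan (critFreq c / c) :=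
    div_mul_cancel₀ _ hwp.ne'
  have hle : h ≤ h₀ := by rwa [hh₀, le_div_iff₀ hwp]
  have hmono := (strictMono_mul_sub_arctan (by linarith)
    (one_lt_mul_of_le_mul_critFreq hc e.ge).1).monotone hn
  have h2 : h * y ≤ h₀ * y := by gcongr
  have h3 := Real.arctan_lt_pi_div_two (y / c)
  have h4 : 0 ≤ Real.cos (h * y - Real.arctan (y / c)) :=
    Real.cos_nonneg_of_mem_Icc ⟨by linarith, by linarith⟩
  have h5 := mul_cos_sub_arctan (show c ≠ 0 by linarith) (h * y) y
  have h6 := mul_neg_of_pos_of_neg (Real.cos_arctan_pos (y / c)) hN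
  linarith [mul_nonneg (show 0 ≤ c by linarith) h4]

/-- Before the critical delay, the right half-plane contains no non-real zeros. -/
theorem IsCharRoot.not_pos_pos {h c x y : ℝ} (hc : 2 ≤ c) (hh0 : 0 ≤ h)
    (hh : h * critFreq c ≤ Real.pi / 2 + Real.arctan (critFreq c / c)) (hx : 0 < x) (hy : 0 < y) :
    ¬ IsCharRoot h c x y := by
  intro H
  have hpi := Real.pi_gt_three
  have hmod := H.modulus
  have hexp := H.exp_mul
  have him := H.2
  have hre := H.1
  set E := Real.exp (-(h * x)) with hE
  have hE0 : 0 < E := Real.exp_pos _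
  have hE1 : E ≤ 1 := Real.exp_le_one_iff.2 (neg_nonpos.2 (by positivity))
  have hEinv : E * Real.exp (h * x) = 1 := by rw [hE, ← Real.exp_add]; simp
  have hadd := Real.add_one_le_exp (h * x)
  have hEhx : E * (h * x + 1) ≤ 1 := by linarith [mul_le_mul_of_nonneg_left hadd hE0.le]
  have hφ0 : 0 ≤ h * y := by positivity
  have hwp := critFreq_pos c
  -- For `x ≥ c / 2` the modulus gives `h y < 1`, and the imaginary parts have incompatible signs
  -- unless `h = 0`, where the real part fails.
  rcases le_or_gt c (2 * x) with hcx | hcx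
  · have hyE : y ≤ E := by
      apply le_of_sq_le_sq _ hE0.le
      have hx1 : 1 ≤ x ^ 2 := one_le_pow₀ (by linarith)
      rw [← hmod, ← one_mul (y ^ 2)]
      exact mul_le_mul (by linarith [sq_nonneg y]) (by linarith [sq_nonneg (c - x)])
        (sq_nonneg y) (by positivity)
    have hφ1 : h * y < 1 := by
      have : y * (h + 1) ≤ 1 := by
        calc y * (h + 1) ≤ E * (h * x + 1) := by gcongr; exact le_mul_of_one_le_right hh0 (by linarith)
          _ ≤ 1 := hEhx
      linarith
    rcases hφ0.lt_or_eq with h1 | h1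
    · have := Real.sin_pos_of_pos_of_lt_pi h1 (by linarith)
      linarith [mul_pos hE0 this, mul_nonneg hy.le (sub_nonneg.2 hcx)]
    · rw [← h1] at him hre
      simp at him hre
      nlinarith
  · have hsin : 0 < Real.sin (h * y) := by
      have : 0 < E * Real.sin (h * y) := by linarith [mul_pos hy (sub_pos.2 hcx)]
      exact (mul_pos_iff_of_pos_left hE0).1 this
    have hN : c * Real.cos (h * y) + y * Real.sin (h * y) < 0 := by
      have : E * (c * Real.cos (h * y) + y * Real.sin (h * y)) < 0 := by
        rw [hexp]
        have : 0 < x * (c * (c - x) + 2 * y ^ 2) :=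
          mul_pos hx (add_pos (mul_pos (by linarith) (by linarith)) (by positivity))
        linarith
      by_contra hn
      push Not at hn
      linarith [mul_nonneg hE0.le hn]
    have hφ : Real.pi / 2 < h * y := by
      by_contra hn
      push Not at hn
      have := Real.cos_nonneg_of_mem_Icc (x := h * y) ⟨by linarith, hn⟩
      linarith [mul_pos hy hsin, mul_nonneg (show 0 ≤ c by linarith) this]
    have hyw := critFreq_lt_of_phase_neg hc hh0 hh hy hN
    have hcx2 : 1 ≤ (c - x) ^ 2 := one_le_pow₀ (by linarith)
    have hy1 : y ≤ 1 := by
      apply le_of_sq_le_sq _ zero_le_one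
      have : y ^ 2 ≤ E ^ 2 := by
        rw [← hmod, ← mul_one (y ^ 2)]
        exact mul_le_mul (by linarith [sq_nonneg x]) (by linarith [sq_nonneg y]) zero_le_one
          (by positivity)
      exact this.trans (pow_le_pow_left₀ hE0.le hE1 2)
    have hh1 : 1 ≤ h := by linarith [mul_le_mul_of_nonneg_left hy1 hh0]
    -- The decay `E ≤ 1 / (x + 1)` outweighs the loss from `c` to `c - x`, so the modulus equation
    -- still gives `y² (y² + c²) ≤ 1`, against `y > w`.
    have hEc : E * c ≤ c - x := by
      have h1 : E * (x + 1) ≤ 1 :=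
        le_trans (by gcongr; exact le_mul_of_one_le_left hx.le hh1) hEhx
      have h2 : c ≤ (c - x) * (x + 1) := by nlinarith
      linarith [mul_le_mul_of_nonneg_left h2 hE0.le,
        mul_le_mul_of_nonneg_left h1 (show 0 ≤ c - x by linarith)]
    have hEc2 : E ^ 2 * c ^ 2 ≤ (c - x) ^ 2 := by
      rw [← mul_pow]
      gcongr
    have hE2 : E ^ 2 ≤ 1 := pow_le_one₀ hE0.le hE1
    have h7 : E ^ 2 * (y ^ 2 + c ^ 2) ≤ (c - x) ^ 2 + y ^ 2 := by
      linarith [mul_le_of_le_one_left (sq_nonneg y) hE2]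
    have h8 : y ^ 2 * (E ^ 2 * (y ^ 2 + c ^ 2)) ≤ E ^ 2 := by
      exact (mul_le_mul (by linarith [sq_nonneg x]) h7 (by positivity) (by positivity)).trans
        hmod.le
    have h9 : critFreq c ^ 2 * (critFreq c ^ 2 + c ^ 2) < y ^ 2 * (y ^ 2 + c ^ 2) := by
      gcongr
    rw [critFreq_sq_mul] at h9
    linarith [mul_lt_mul_of_pos_left h9 (pow_pos hE0 2)]

/-- Beyond the critical delay, non-real zeros in the closed left half-plane oscillate fast. -/
theorem IsCharRoot.two_pi_lt {h c x y : ℝ} (hc : 2 ≤ c)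
    (hh : Real.pi / 2 + Real.arctan (critFreq c / c) < h * critFreq c) (hx : x ≤ 0) (hy : 0 < y)
    (H : IsCharRoot h c x y) : 2 * Real.pi < h * y := by
  by_contra hφ2
  push Not at hφ2
  have hpi := Real.pi_gt_three
  have hmod := H.modulus
  have hexp := H.exp_mul
  have him := H.2
  obtain ⟨hch, hhc⟩ := one_lt_mul_of_le_mul_critFreq hc hh.le
  have hh0 : 0 < h := by nlinarith
  set E := Real.exp (-(h * x)) with hE
  have hE0 : 0 < E := Real.exp_pos _
  have hwp := critFreq_pos c
  have hw1 := critFreq_lt_one (show 0 < c by linarith)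
  have hφ0 : 0 < h * y := by positivity
  have hsin : 0 < Real.sin (h * y) := by
    have : 0 < E * Real.sin (h * y) := by nlinarith
    exact (mul_pos_iff_of_pos_left hE0).1 this
  have hφ : h * y < Real.pi := by
    by_contra hn
    push Not at hn
    have h1 := Real.sin_nonneg_of_nonneg_of_le_pi (x := h * y - Real.pi) (by linarith)
      (by linarith)
    rw [Real.sin_sub_pi] at h1
    linarith
  have hN : 0 ≤ c * Real.cos (h * y) + y * Real.sin (h * y) := by
    have : 0 ≤ E * (c * Real.cos (h * y) + y * Real.sin (h * y)) := by
      rw [hexp]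
      exact mul_nonneg (by linarith) (by nlinarith)
    exact nonneg_of_mul_nonneg_right this hE0
  have hyw : y < critFreq c := by
    by_contra hn
    push Not at hn
    have hmono := (strictMono_mul_sub_arctan (by linarith) hch).monotone hn
    have h1 : 0 < Real.arctan (y / c) := Real.arctan_pos.2 (by positivity)
    have h2 : Real.cos (h * y - Real.arctan (y / c)) < 0 :=
      Real.cos_neg_of_pi_div_two_lt_of_lt (by linarith) (by linarith)
    have h5 := mul_cos_sub_arctan (show c ≠ 0 by linarith) (h * y) y
    have h6 := mul_nonneg (Real.cos_arctan_pos (y / c)).le hN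
    linarith [mul_neg_of_pos_of_neg (show 0 < c by linarith) h2]
  obtain ⟨t, rfl⟩ : ∃ t, x = -t := ⟨-x, by ring⟩
  have ht : 0 ≤ t := by linarith
  -- This splits the exponential into factors dominating `1 + t / w` and `1 + t / c`, whose product
  -- exceeds the modulus of `z (z - c)`.
  have hsum : 1 / critFreq c + 1 / c ≤ h := by
    have h1 : 1 / c ≤ 1 / 2 := by gcongr
    have h2 : 1 ≤ 1 / critFreq c := by rw [le_div_iff₀ hwp]; linarith
    have h3 : Real.pi / 2 * (1 / critFreq c) ≤ h := by
      rw [mul_one_div, div_le_iff₀ hwp]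
      have : 0 < Real.arctan (critFreq c / c) := Real.arctan_pos.2 (by positivity)
      linarith
    nlinarith
  have hElow : (t / critFreq c + 1) * (t / c + 1) ≤ E := by
    calc _ ≤ Real.exp (t / critFreq c) * Real.exp (t / c) := by
          gcongr
          · exact Real.add_one_le_exp _
          · exact Real.add_one_le_exp _
      _ = Real.exp ((1 / critFreq c + 1 / c) * t) := by rw [← Real.exp_add]; ring_nf
      _ ≤ E := by
          rw [hE]
          gcongr
          nlinarith
  have h1 : ((t / critFreq c + 1) * (t / c + 1)) ^ 2 =
      (critFreq c + t) ^ 2 * ((c + t) ^ 2 + (critFreq c * (t / c + 1)) ^ 2) := by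
    have e : (critFreq c + t) ^ 2 * ((c + t) ^ 2 + (critFreq c * (t / c + 1)) ^ 2) =
        ((t / critFreq c + 1) * (t / c + 1)) ^ 2 *
          (critFreq c ^ 2 * (critFreq c ^ 2 + c ^ 2)) := by
      have : c ≠ 0 := by linarith
      field_simp
      ring
    rw [e, critFreq_sq_mul, mul_one]
  have h2 : ((-t) ^ 2 + y ^ 2) * ((c - -t) ^ 2 + y ^ 2) <
      (critFreq c + t) ^ 2 * ((c + t) ^ 2 + (critFreq c * (t / c + 1)) ^ 2) := by
    have h3 : y ≤ critFreq c * (t / c + 1) := by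
      have : 0 ≤ t / c := by positivity
      nlinarith
    have h4 : (-t) ^ 2 + y ^ 2 < (critFreq c + t) ^ 2 := by
      have h6 : y ^ 2 < critFreq c ^ 2 := by gcongr
      linarith [mul_nonneg hwp.le ht]
    have h5 : (c - -t) ^ 2 + y ^ 2 ≤ (c + t) ^ 2 + (critFreq c * (t / c + 1)) ^ 2 := by
      rw [sub_neg_eq_add]
      gcongr
    exact mul_lt_mul h4 h5 (by positivity) (by positivity)
  rw [hmod, ← h1] at h2
  exact absurd h2 (not_lt.2 (by gcongr))

/-- With `t = -x`, `exp (h t) ≥ 1 + h t + h² t² / 2` exceeds `t² + c t`, since `h > c ≥ 2`. -/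
theorem IsCharRoot.not_nonpos_real {h c x : ℝ} (hc : 2 ≤ c) (hh : Real.pi / 2 * c < h)
    (hx : x ≤ 0) : ¬ IsCharRoot h c x 0 := by
  intro H
  have hpi := Real.pi_gt_three
  have h1 := H.1
  simp only [mul_zero, Real.cos_zero, mul_one] at h1
  have hhc : c < h := by nlinarith
  have h2 := Real.quadratic_le_exp_of_nonneg (x := -(h * x)) (by nlinarith)
  have h3 : x ^ 2 * 2 ≤ x ^ 2 * h ^ 2 := by gcongr; nlinarith
  nlinarith

/-- Beyond the critical delay there is a non-real zero in the right half-plane. -/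
theorem exists_isCharRoot_pos {h c : ℝ} (hc : 2 ≤ c)
    (hh : Real.pi / 2 + Real.arctan (critFreq c / c) < h * critFreq c) :
    ∃ x y, 0 < x ∧ 0 < y ∧ IsCharRoot h c x y := by
  have hpi := Real.pi_gt_three
  obtain ⟨hch, hhc⟩ := one_lt_mul_of_le_mul_critFreq hc hh.le
  have hc0 : 0 < c := by linarith
  have hh0 : 0 < h := by nlinarith
  have hwp := critFreq_pos c
  have hmono := strictMono_mul_sub_arctan hc0 hch
  obtain ⟨y₀, ⟨hy₀, hy₀w⟩, hy₀e⟩ := intermediate_value_Icc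
    (f := fun y => h * y - Real.arctan (y / c)) hwp.le (by fun_prop)
    (show Real.pi / 2 ∈ _ by simp; constructor <;> linarith)
  simp only at hy₀e
  have hy₀pos : 0 < y₀ := by
    rcases hy₀.lt_or_eq with h1 | h1
    · exact h1
    · rw [← h1] at hy₀e; simp at hy₀e; linarith
  have hy₀lt : y₀ < critFreq c := by
    rcases hy₀w.lt_or_eq with h1 | h1
    · exact h1
    · rw [h1] at hy₀e; linarith
  have hy₀pi : y₀ ≤ Real.pi / h := by
    rw [le_div_iff₀ hh0]
    linarith [Real.arctan_lt_pi_div_two (y₀ / c)]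
  -- On this curve `z (z - c)` has argument `-h y` and modulus `2 y m`. The imaginary part gives
  -- `X`, the real part a quadratic for `m`; the root is rationalized as `D / Q` because `sin (h y)`
  -- vanishes at `y = π / h`. A zero is a point with `G = 1`.
  set D : ℝ → ℝ := fun y => c ^ 2 / 4 + y ^ 2 with hD
  set S : ℝ → ℝ := fun y => Real.sqrt (y ^ 2 + c ^ 2 / 4 * Real.sin (h * y) ^ 2) with hS
  set Q : ℝ → ℝ := fun y => S y - y * Real.cos (h * y) with hQ
  set m : ℝ → ℝ := fun y => D y / Q y with hm
  set X : ℝ → ℝ := fun y => c / 2 - m y * Real.sin (h * y) with hX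
  set G : ℝ → ℝ := fun y => 2 * y * m y * Real.exp (h * X y) with hG
  have hphase : ∀ y ∈ Set.Icc y₀ (Real.pi / h), 0 < y ∧ Real.pi / 2 < h * y ∧ h * y ≤ Real.pi := by
    intro y hy
    have h1 := hmono.monotone hy.1
    have hy0 : 0 < y := hy₀pos.trans_le hy.1
    have h2 : 0 < Real.arctan (y / c) := Real.arctan_pos.2 (by positivity)
    have h3 := (le_div_iff₀ hh0).1 hy.2
    exact ⟨hy0, by linarith, by linarith⟩
  have hcos : ∀ y ∈ Set.Icc y₀ (Real.pi / h), Real.cos (h * y) < 0 := by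
    intro y hy
    obtain ⟨_, h2, h3⟩ := hphase y hy
    exact Real.cos_neg_of_pi_div_two_lt_of_lt h2 (by linarith)
  have hsin : ∀ y ∈ Set.Icc y₀ (Real.pi / h), 0 ≤ Real.sin (h * y) := by
    intro y hy
    obtain ⟨_, h2, h3⟩ := hphase y hy
    exact Real.sin_nonneg_of_nonneg_of_le_pi (by linarith) h3
  have hQpos : ∀ y ∈ Set.Icc y₀ (Real.pi / h), 0 < Q y := by
    intro y hy
    have h1 : 0 ≤ S y := Real.sqrt_nonneg _
    have h2 := mul_neg_of_pos_of_neg (hphase y hy).1 (hcos y hy)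
    simp only [hQ]
    linarith
  have hmpos : ∀ y ∈ Set.Icc y₀ (Real.pi / h), 0 < m y := fun y hy =>
    div_pos (by simp only [hD]; positivity) (hQpos y hy)
  have hquad : ∀ y ∈ Set.Icc y₀ (Real.pi / h),
      m y ^ 2 * Real.sin (h * y) ^ 2 = 2 * y * m y * Real.cos (h * y) + D y := by
    intro y hy
    have hq := hQpos y hy
    have h1 : m y * Q y = D y := div_mul_cancel₀ _ hq.ne'
    have h2 : S y ^ 2 = y ^ 2 + c ^ 2 / 4 * Real.sin (h * y) ^ 2 := Real.sq_sqrt (by positivity)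
    have h3 : S y = Q y + y * Real.cos (h * y) := by simp only [hQ]; ring
    have h4 := Real.sin_sq_add_cos_sq (h * y)
    have h5 : Q y ^ 2 + 2 * y * Real.cos (h * y) * Q y = D y * Real.sin (h * y) ^ 2 := by
      rw [h3] at h2
      simp only [hD]
      linear_combination h2 - y ^ 2 * h4
    have h6 : Q y * (m y ^ 2 * Real.sin (h * y) ^ 2) =
        Q y * (2 * y * m y * Real.cos (h * y) + D y) := by
      linear_combination (m y * Real.sin (h * y) ^ 2 + Q y) * h1 - m y * h5
    exact mul_left_cancel₀ hq.ne' h6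
  have hXeq : ∀ y ∈ Set.Icc y₀ (Real.pi / h),
      X y * (Real.sin (h * y) * (c / 2 + m y * Real.sin (h * y)) - 2 * y * Real.cos (h * y)) =
        -y * (c * Real.cos (h * y) + y * Real.sin (h * y)) := by
    intro y hy
    have h1 := hquad y hy
    simp only [hD] at h1
    simp only [hX]
    linear_combination (-Real.sin (h * y)) * h1
  have hfac : ∀ y ∈ Set.Icc y₀ (Real.pi / h),
      0 < Real.sin (h * y) * (c / 2 + m y * Real.sin (h * y)) - 2 * y * Real.cos (h * y) := by
    intro y hy
    have h2 := mul_neg_of_pos_of_neg (hphase y hy).1 (hcos y hy)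
    have h3 := hsin y hy
    have h4 := hmpos y hy
    have h5 : 0 ≤ Real.sin (h * y) * (c / 2 + m y * Real.sin (h * y)) := by positivity
    linarith
  have hN : ∀ y, 0 < Real.cos (Real.arctan (y / c)) := fun y => Real.cos_arctan_pos _
  have hX₀ : X y₀ = 0 := by
    have hmem : y₀ ∈ Set.Icc y₀ (Real.pi / h) := ⟨le_rfl, hy₀pi⟩
    have h1 := mul_cos_sub_arctan hc0.ne' (h * y₀) y₀
    rw [hy₀e, Real.cos_pi_div_two, mul_zero] at h1
    have h2 := (mul_eq_zero.1 h1.symm).resolve_left (hN y₀).ne'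
    have h3 := hXeq y₀ hmem
    rw [h2, mul_zero] at h3
    exact (mul_eq_zero.1 h3).resolve_right (hfac y₀ hmem).ne'
  have hXpos : ∀ y ∈ Set.Icc y₀ (Real.pi / h), y₀ < y → 0 < X y := by
    intro y hy hlt
    have h1 := hmono hlt
    have h2 := hphase y hy
    have h3 : 0 < Real.arctan (y / c) := Real.arctan_pos.2 (div_pos h2.1 hc0)
    have h4 : Real.cos (h * y - Real.arctan (y / c)) < 0 :=
      Real.cos_neg_of_pi_div_two_lt_of_lt (by linarith) (by linarith)
    have h5 := mul_cos_sub_arctan hc0.ne' (h * y) y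
    have h6 : c * Real.cos (h * y) + y * Real.sin (h * y) < 0 := by
      by_contra hn
      push Not at hn
      nlinarith [mul_nonneg (hN y).le hn]
    have h7 := hXeq y hy
    have h8 := mul_pos_of_neg_of_neg (neg_lt_zero.2 h2.1) h6
    rw [← h7] at h8
    exact (pos_iff_pos_of_mul_pos h8).2 (hfac y hy)
  have hroot : ∀ y ∈ Set.Icc y₀ (Real.pi / h),
      X y ^ 2 - y ^ 2 - c * X y = 2 * y * m y * Real.cos (h * y) ∧
        2 * X y * y - c * y = -(2 * y * m y * Real.sin (h * y)) := by
    intro y hy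
    have h1 := hquad y hy
    simp only [hD] at h1
    constructor
    · simp only [hX]
      linear_combination h1
    · simp only [hX]
      ring
  have hcont : ContinuousOn G (Set.Icc y₀ (Real.pi / h)) := by
    have hQc : Continuous Q := by simp only [hQ, hS]; fun_prop
    have hDc : Continuous D := by simp only [hD]; fun_prop
    have hmc : ContinuousOn m (Set.Icc y₀ (Real.pi / h)) :=
      hDc.continuousOn.div hQc.continuousOn fun y hy => (hQpos y hy).ne'
    simp only [hG, hX]
    fun_prop
  -- The curve starts on the imaginary axis below the critical frequency, where the modulus is less
  -- than 1.
  have hG₀ : G y₀ < 1 := by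
    have hmem : y₀ ∈ Set.Icc y₀ (Real.pi / h) := ⟨le_rfl, hy₀pi⟩
    obtain ⟨h1, h2⟩ := hroot y₀ hmem
    have h3 := Real.sin_sq_add_cos_sq (h * y₀)
    rw [hX₀] at h1 h2
    have h4 : (2 * y₀ * m y₀) ^ 2 = y₀ ^ 2 * (y₀ ^ 2 + c ^ 2) := by
      calc (2 * y₀ * m y₀) ^ 2
          = (2 * y₀ * m y₀ * Real.cos (h * y₀)) ^ 2 +
            (-(2 * y₀ * m y₀ * Real.sin (h * y₀))) ^ 2 := by
              linear_combination -(2 * y₀ * m y₀) ^ 2 * h3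
        _ = _ := by rw [← h1, ← h2]; ring
    have h5 : y₀ ^ 2 * (y₀ ^ 2 + c ^ 2) < critFreq c ^ 2 * (critFreq c ^ 2 + c ^ 2) := by gcongr
    rw [critFreq_sq_mul, ← h4] at h5
    simp only [hG, hX₀, mul_zero, Real.exp_zero, mul_one]
    exact lt_of_pow_lt_pow_left₀ 2 zero_le_one (by simpa using h5)
  have hG₁ : 1 ≤ G (Real.pi / h) := by
    have hmem : Real.pi / h ∈ Set.Icc y₀ (Real.pi / h) := ⟨hy₀pi, le_rfl⟩
    obtain ⟨hp, -, -⟩ := hphase _ hmem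
    have e : h * (Real.pi / h) = Real.pi := mul_div_cancel₀ _ hh0.ne'
    have hm1 := hquad _ hmem
    rw [e] at hm1
    simp only [hD, Real.sin_pi, Real.cos_pi] at hm1
    have h1 : 1 ≤ 2 * (Real.pi / h) * m (Real.pi / h) := by
      nlinarith [pow_pos hp 2]
    have h2 : X (Real.pi / h) = c / 2 := by simp only [hX, e, Real.sin_pi]; ring
    have h3 : 1 ≤ Real.exp (h * X (Real.pi / h)) := by
      rw [h2]
      exact Real.one_le_exp (by positivity)
    exact one_le_mul_of_one_le_of_one_le h1 h3
  obtain ⟨y, hy, hGy⟩ := intermediate_value_Icc hy₀pi hcont ⟨hG₀.le, hG₁⟩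
  have hne : y₀ < y := by
    rcases hy.1.lt_or_eq with h1 | h1
    · exact h1
    · rw [← h1] at hGy; linarith
  have hexp : 2 * y * m y = Real.exp (-(h * X y)) := by
    rw [Real.exp_neg]
    exact eq_inv_of_mul_eq_one_left hGy
  obtain ⟨h1, h2⟩ := hroot y hy
  rw [hexp] at h1 h2
  exact ⟨X y, y, hXpos y hy hne, (hphase y hy).1, h1, h2⟩

/-! ### The positive real zero -/

theorem exists_isCharRoot_real {h c : ℝ} (hc : 2 ≤ c) (hh : 0 ≤ h) :
    ∃ x, c ≤ x ∧ IsCharRoot h c x 0 := by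
  obtain ⟨x, ⟨hx, -⟩, hx0⟩ := intermediate_value_Icc
    (f := fun x => x ^ 2 - c * x - Real.exp (-(h * x))) (show c ≤ c + 1 by linarith) (by fun_prop)
    (show (0 : ℝ) ∈ _ by
      constructor
      · nlinarith [Real.exp_pos (-(h * c))]
      · have : Real.exp (-(h * (c + 1))) ≤ 1 := Real.exp_le_one_iff.2 (by nlinarith)
        nlinarith)
  simp only at hx0
  refine ⟨x, hx, ?_, ?_⟩
  · simp
    linarith
  · simp

/-- Positive real zeros exceed `c`, where `x² - c x` increases while the exponential does not. -/
theorem IsCharRoot.real_unique {h c x x' : ℝ} (hh : 0 ≤ h) (hx : 0 < x) (hx' : 0 < x')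
    (H : IsCharRoot h c x 0) (H' : IsCharRoot h c x' 0) : x = x' := by
  wlog hlt : x < x' generalizing x x'
  · rcases (not_lt.1 hlt).lt_or_eq with h1 | h1
    · exact (this hx' hx H' H h1).symm
    · exact h1.symm
  have h1 := H.1
  have h2 := H'.1
  simp only [mul_zero, Real.cos_zero, mul_one] at h1 h2
  have h3 : Real.exp (-(h * x')) ≤ Real.exp (-(h * x)) := by gcongr
  have h4 := Real.exp_pos (-(h * x))
  have h5 : c < x := by nlinarith
  nlinarith

theorem analyticOrderAt_charFun8_ofReal {τ c x : ℝ} (hc : 0 < c) (hτ : 0 ≤ τ) (hx : c ≤ x)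
    (h0 : charFun8 τ c x = 0) : analyticOrderAt (charFun8 τ c) x = 1 := by
  have hd : ∀ z : ℂ, HasDerivAt (charFun8 τ c)
      (2 * z - c - Complex.exp (-z * c * τ) * (-1 * c * τ)) z := by
    intro z
    have h1 := ((hasDerivAt_pow 2 z).sub ((hasDerivAt_id z).const_mul (c : ℂ))).sub
      ((((hasDerivAt_id z).neg.mul_const (c : ℂ)).mul_const (τ : ℂ)).cexp)
    exact (show HasDerivAt (charFun8 τ c) _ z from h1).congr_deriv (by simp)
  have han : AnalyticAt ℂ (charFun8 τ c) x :=
    Differentiable.analyticAt (fun z => (hd z).differentiableAt) _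
  refine han.analyticOrderAt_eq_one_of_zero_deriv_ne_zero h0 ?_
  rw [(hd x).deriv]
  have e : (2 * (x : ℂ) - c - Complex.exp (-x * c * τ) * (-1 * c * τ)) =
      ((2 * x - c + Real.exp (-x * c * τ) * (c * τ) : ℝ) : ℂ) := by
    push_cast
    ring
  rw [e, Complex.ofReal_ne_zero]
  have : 0 ≤ Real.exp (-x * c * τ) * (c * τ) := by positivity
  linarith

/-! ### Zero count and critical speed -/

theorem hasExactlyOneZeroIn_charFun8_iff {τ c : ℝ} (hτ : 0 ≤ τ) (hc : 2 ≤ c) :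
    HasExactlyOneZeroIn (charFun8 τ c) {z : ℂ | 0 < z.re} ↔ τ ≤ critDelay c := by
  have hwp := critFreq_pos c
  have hcrit : τ ≤ critDelay c ↔
      c * τ * critFreq c ≤ Real.pi / 2 + Real.arctan (critFreq c / c) := by
    rw [critDelay, arccos_neg_critFreq_sq (by linarith), le_div_iff₀ (by positivity)]
    ring_nf
  have hcτ : 0 ≤ c * τ := by positivity
  rw [hcrit]
  constructor
  · rintro ⟨z, -, -, -, huniq⟩
    by_contra hn
    obtain ⟨x, y, hx, hy, H⟩ := exists_isCharRoot_pos hc (not_le.1 hn)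
    -- A non-real zero and its conjugate cannot both equal the single zero.
    have h1 := huniq ⟨x, y⟩ hx ((charFun8_eq_zero_iff _ _ _).2 H)
    have h2 := huniq ⟨x, -y⟩ hx ((charFun8_eq_zero_iff _ _ _).2 H.neg)
    have h3 := congrArg Complex.im (h1.trans h2.symm)
    simp only at h3
    linarith
  · intro hle
    obtain ⟨x, hx, H⟩ := exists_isCharRoot_real hc hcτ
    have h0 : charFun8 τ c x = 0 := (charFun8_eq_zero_iff _ _ _).2 (by rwa [Complex.ofReal_re, Complex.ofReal_im])
    have hx0 : 0 < x := by linarith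
    refine ⟨x, by simpa using hx0, h0,
      analyticOrderAt_charFun8_ofReal (by linarith) hτ hx h0, fun z hz hz0 => ?_⟩
    have hz' : 0 < z.re := hz
    have Hz : IsCharRoot (c * τ) c z.re z.im := (charFun8_eq_zero_iff _ _ _).1 hz0
    rcases lt_trichotomy z.im 0 with hi | hi | hi
    · exact absurd Hz.neg (IsCharRoot.not_pos_pos hc hcτ hle hz' (by linarith))
    · rw [hi] at Hz
      exact Complex.ext (by simpa using Hz.real_unique hcτ hz' hx0 H) (by simpa using hi)
    · exact absurd Hz (IsCharRoot.not_pos_pos hc hcτ hle hz' hi)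

theorem two_pi_div_lt_abs_im {τ c : ℝ} (hc : 2 ≤ c) (hlt : critDelay c < τ) {z : ℂ}
    (hz : charFun8 τ c z = 0) (hre : z.re ≤ 0) : 2 * Real.pi / (c * τ) < |z.im| := by
  have hwp := critFreq_pos c
  have hh : Real.pi / 2 + Real.arctan (critFreq c / c) < c * τ * critFreq c := by
    rw [critDelay, arccos_neg_critFreq_sq (by linarith), div_lt_iff₀ (by positivity)] at hlt
    linarith
  have H : IsCharRoot (c * τ) c z.re z.im := (charFun8_eq_zero_iff _ _ _).1 hz
  have hhc := (one_lt_mul_of_le_mul_critFreq hc hh.le).2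
  have hpos : 0 < c * τ := by nlinarith [Real.pi_pos]
  rw [div_lt_iff₀' hpos]
  rcases lt_trichotomy z.im 0 with hi | hi | hi
  · rw [abs_of_neg hi]
    exact H.neg.two_pi_lt hc hh hre (by linarith)
  · rw [hi] at H
    exact absurd H (IsCharRoot.not_nonpos_real hc hhc hre)
  · rw [abs_of_pos hi]
    exact H.two_pi_lt hc hh hre hi

theorem isCritSpeed_iff_of_le {τ : ℝ} (h : τ ≤ Real.pi / 2) (C : EReal) :
    IsCritSpeed τ C ↔ C = ⊤ := by
  simp [IsCritSpeed, h, not_lt.2 h]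

theorem isCritSpeed_iff_of_lt {τ : ℝ} (h : Real.pi / 2 < τ) (C : EReal) :
    IsCritSpeed τ C ↔ ∃ c : ℝ, 0 < c ∧ C = c ∧ τ = critDelay c := by
  simp [IsCritSpeed, h, not_le.2 h, critDelay]

theorem IsCritSpeed.coe_le_iff {τ c : ℝ} {C : EReal} (hC : IsCritSpeed τ C) (hc : 0 < c) :
    (c : EReal) ≤ C ↔ τ ≤ critDelay c := by
  rcases le_or_gt τ (Real.pi / 2) with h | h
  · rw [(isCritSpeed_iff_of_le h C).1 hC]
    simp only [le_top, true_iff]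
    exact h.trans (pi_div_two_lt_critDelay hc).le
  · obtain ⟨c', hc', rfl, rfl⟩ := (isCritSpeed_iff_of_lt h C).1 hC
    rw [EReal.coe_le_coe_iff]
    exact (critDelay_strictAntiOn.le_iff_ge hc' hc).symm

theorem mainTheorem8 :
    (1.86173 ≤ tauTwo ∧ tauTwo < 1.86174) ∧
    (∀ τ : ℝ, 0 ≤ τ → ∃! C : EReal, IsCritSpeed τ C) ∧
    (∀ (τ : ℝ) (C : EReal), 0 ≤ τ → IsCritSpeed τ C → (2 ≤ C ↔ τ ≤ tauTwo)) ∧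
    (∀ (τ c : ℝ) (C : EReal), 0 ≤ τ → 2 ≤ c → IsCritSpeed τ C →
      (HasExactlyOneZeroIn (charFun8 τ c) {z : ℂ | 0 < z.re} ↔
        (τ ≤ Real.pi / 2 ∧ (c : EReal) ≤ C) ∨
          (Real.pi / 2 < τ ∧ τ ≤ tauTwo ∧ (c : EReal) ≤ C)) ∧
      (C < (c : EReal) → ∀ z : ℂ, charFun8 τ c z = 0 → z.re ≤ 0 →
        2 * Real.pi / (c * τ) < |z.im|)) := by
  refine ⟨tauTwo_bounds, fun τ _ => ?_, fun τ C _ hC => ?_, fun τ c C hτ hc hC => ⟨?_, ?_⟩⟩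
  · rcases le_or_gt τ (Real.pi / 2) with h | h
    · simp [isCritSpeed_iff_of_le h]
    · obtain ⟨c, hc, rfl⟩ := exists_critDelay_eq h
      refine ⟨c, (isCritSpeed_iff_of_lt h _).2 ⟨c, hc, rfl, rfl⟩, fun C hC => ?_⟩
      obtain ⟨c', hc', rfl, he⟩ := (isCritSpeed_iff_of_lt h C).1 hC
      rw [critDelay_strictAntiOn.injOn hc' hc he.symm]
  · rw [tauTwo_eq]
    exact_mod_cast hC.coe_le_iff two_pos
  · rw [hasExactlyOneZeroIn_charFun8_iff hτ hc, hC.coe_le_iff (by linarith)]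
    have hanti : critDelay c ≤ tauTwo := by
      rw [tauTwo_eq]
      exact critDelay_strictAntiOn.antitoneOn (Set.mem_Ioi.2 two_pos)
        (Set.mem_Ioi.2 (by linarith)) hc
    constructor
    · intro h
      rcases le_or_gt τ (Real.pi / 2) with h1 | h1
      · exact Or.inl ⟨h1, h⟩
      · exact Or.inr ⟨h1, h.trans hanti, h⟩
    · rintro (⟨-, h⟩ | ⟨-, -, h⟩) <;> exact h
  · intro hlt z hz hre
    refine two_pi_div_lt_abs_im hc ?_ hz hre
    rw [← not_le, hC.coe_le_iff (by linarith)] at hlt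
    exact not_le.1 hlt
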